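/- For a graph $G$ and (not necessarily disjoint) vertex subsets $A,B\subseteq V(G)$, let $e(A,B)$ be the number of ordered pairs $(a,b)\in A\times B$ such that $\{a,b\}$ is an edge of $G$. For real $c$ and $t$, the graph $G$ is called $(c,t)$-sparse if $e(A,B)\le (1-c)|A||B|$ for all $A,B\subseteq V(G)$ with $|A|,|B|\ge t$. Theorem. For every real $c>0$ and every integer $\ell\ge 2$ there exists a constant $C>1$ such that the following holds. If $G$ is a graph on $n\ge 1$ vertices that is $(c,t)$-sparse for some real $t>0$ and has at least $C\,t^{1-1/\ell}n^{1+1/\ell}$ edges, then $G$ contains an induced copy of $C_{2\ell}$, the cycle of length $2\ell$. -/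

import Mathlib

/-- A graph `G` is `(c, t)`-sparse if for all (not necessarily disjoint) vertex subsets `A`, `B`
with `|A|, |B| ≥ t` we have `e(A, B) ≤ (1 - c)|A||B|`. Here `e(A, B)` is the number of ordered
pairs `(a, b) ∈ A × B` such that `a` and `b` are adjacent (so edges inside `A ∩ B` count twice);
this is the cardinality of `G.interedges A B`. -/
def SimpleGraph.IsLocallySparse {V : Type*} (G : SimpleGraph V) [DecidableRel G.Adj]
    (c t : ℝ) : Prop :=
  ∀ A B : Finset V, t ≤ (A.card : ℝ) → t ≤ (B.card : ℝ) →
    ((G.interedges A B).card : ℝ) ≤ (1 - c) * (A.card : ℝ) * (B.card : ℝ)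

/-!
Suppose that `G` is `(c, t)`-sparse with many edges and has no induced cycle of length `2 * ℓ`. The
proof first makes the sparseness as strong as needed for a union bound, and then finds the cycle
among the closed walks of length `2 * ℓ`.

A pair of sets of size at least a large multiple `K * t` and of density above a fixed `ε` contains
every bipartite graph as an induced subgraph
(`SimpleGraph.exists_forall_isIndContained_of_dense_pair`): a density increment gives a subpair
whose large subpairs have positive density, sparseness gives many non-adjacent pairs between any
two large sets, and the copy is built greedily. So every such pair has density at most `ε`; in
other words `G` is `(1 - ε, K * t)`-sparse, with `ε` as small as desired. It suffices to take `ε` a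
small constant divided by `ℓ ^ 2`.

Closed walks are weighted by the entries of the normalized adjacency matrix `N`. Let `S j` be the
squared Frobenius norm of `N ^ j`, so that `S ℓ` is the total weight of the closed walks of length
`2 * ℓ`. The sequence `S` is log-convex, with `S 1 ≤ |V| / δ` for `δ` of the order of the average
degree and `S ℓ ≥ (1 / 4) ^ ℓ`. The number of edges is just enough to conclude that `S ℓ` is at
least a large multiple of `t / δ * S (ℓ - 1)`.

Two vertices `x`, `y` of the walk at cyclic distance at least two lie strictly on different sides of
two antipodal vertices `u`, `v`, which can be chosen so that `y` is next to `u`. For given `u` and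
`v` the vertices `x` and `y` are independent, of weights `f` and `g` with the same total mass
`W = (N ^ ℓ) u v`. The parts of `f` and `g` with atoms below `W / L`, where `L` is a large multiple
of `t`, meet the relation `adjacent or equal` with weight at most a small multiple of `W ^ 2`, by
sparseness. The weight due to larger atoms is at most `L` times the sums of the squares of `f` and
`g` (`sum_sum_mul_le_of_sparse`). Summed over `u` and `v`, the squares give
`∑ z, (N ^ (2 * k)) z z * (N ^ (2 * ℓ - 2 * k)) z z`, which by log-convexity at each vertex `z` is
largest for `k = 1`, hence at most `S (ℓ - 1) / δ`; and `L / δ * S (ℓ - 1)` is small compared with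
`S ℓ`. A union bound over all pairs of positions leaves a closed walk of positive weight with
neither chords nor repeated vertices: an induced cycle
(`SimpleGraph.cycleGraph_isIndContained_of_sparse`).
-/

/-! ### Log-convex sequences -/

/-- A nonnegative sequence with `a (i + 1) ^ 2 ≤ a i * a (i + 2)`; zeros are allowed. -/
structure IsLogConvexSeq (a : ℕ → ℝ) : Prop where
  nonneg : ∀ i, 0 ≤ a i
  sq_le : ∀ i, a (i + 1) ^ 2 ≤ a i * a (i + 2)

namespace IsLogConvexSeq

variable {a : ℕ → ℝ}

lemma succ_mul_le (h : IsLogConvexSeq a) {i j : ℕ} (hij : i ≤ j) :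
    a (i + 1) * a j ≤ a i * a (j + 1) := by
  induction j, hij using Nat.le_induction with
  | base => rw [mul_comm]
  | succ j _ ih =>
    rcases (h.nonneg (j + 1)).eq_or_lt with h0 | h0
    · rw [← h0, mul_zero]
      exact mul_nonneg (h.nonneg _) (h.nonneg _)
    · refine le_of_mul_le_mul_right ?_ h0
      calc a (i + 1) * a (j + 1) * a (j + 1) = a (i + 1) * a (j + 1) ^ 2 := by ring
        _ ≤ a (i + 1) * (a j * a (j + 2)) := by gcongr; exacts [h.nonneg _, h.sq_le j]
        _ = a (i + 1) * a j * a (j + 2) := by ring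
        _ ≤ a i * a (j + 1) * a (j + 2) := by gcongr; exact h.nonneg _
        _ = a i * a (j + 1 + 1) * a (j + 1) := by ring

/-- Moving two indices apart, down to `1`, increases the product. -/
lemma mul_le_one_mul (h : IsLogConvexSeq a) (i j : ℕ) :
    a (i + 1) * a (j + 1) ≤ a 1 * a (i + j + 1) := by
  wlog hij : i ≤ j generalizing i j
  · rw [mul_comm, add_comm i j]
    exact this j i (by omega)
  induction i generalizing j with
  | zero => simp
  | succ i ih =>
    calc a (i + 1 + 1) * a (j + 1) ≤ a (i + 1) * a (j + 1 + 1) := h.succ_mul_le (by omega)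
      _ ≤ a 1 * a (i + (j + 1) + 1) := ih _ (by omega)
      _ = a 1 * a (i + 1 + j + 1) := by congr 2; omega

lemma pow_mul_le (h : IsLogConvexSeq a) {q : ℝ} (hq : 0 ≤ q) (h0 : 0 < a 0)
    (h1 : q * a 0 ≤ a 1) (n : ℕ) : q ^ n * a 0 ≤ a n := by
  induction n with
  | zero => simp
  | succ n ih =>
    refine le_of_mul_le_mul_right ?_ h0
    calc q ^ (n + 1) * a 0 * a 0 = (q ^ n * a 0) * (q * a 0) := by ring
      _ ≤ a n * a 1 := mul_le_mul ih h1 (by positivity) (h.nonneg _)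
      _ = a (0 + 1) * a n := by ring
      _ ≤ a 0 * a (n + 1) := h.succ_mul_le (Nat.zero_le _)
      _ = a (n + 1) * a 0 := mul_comm _ _

/-- The ratio of the terms at the indices `n` and `n + 1`, the largest one up to there, is at least
`ρ` if the product of the `n` ratios after the index `1` is at least `ρ ^ n`. -/
lemma mul_le_of_pow_mul_le (h : IsLogConvexSeq a) {ρ : ℝ} (hρ : 0 ≤ ρ) {n : ℕ}
    (hpos : 0 < a n) (hn : 1 ≤ n) (h1 : ρ ^ n * a 1 ≤ a (n + 1)) :
    ρ * a n ≤ a (n + 1) := by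
  by_contra! hlt
  have hstep : ∀ i, i < n → a (i + 1) ≤ ρ * a i := fun i hi ↦ by
    refine le_of_mul_le_mul_right ?_ hpos
    calc a (i + 1) * a n ≤ a i * a (n + 1) := h.succ_mul_le hi.le
      _ ≤ a i * (ρ * a n) := mul_le_mul_of_nonneg_left hlt.le (h.nonneg i)
      _ = ρ * a i * a n := by ring
  have hchain : ∀ i, i < n → a (i + 1) ≤ ρ ^ i * a 1 := fun i ↦ by
    induction i with
    | zero => simp
    | succ i ih =>
      intro hi
      calc a (i + 1 + 1) ≤ ρ * a (i + 1) := hstep _ hi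
        _ ≤ ρ * (ρ ^ i * a 1) := by gcongr; exact ih (by omega)
        _ = ρ ^ (i + 1) * a 1 := by ring
  obtain ⟨m, rfl⟩ : ∃ m, n = m + 1 := ⟨n - 1, by omega⟩
  have := hchain m (by omega)
  have : a (m + 1 + 1) < ρ ^ (m + 1) * a 1 := by
    calc a (m + 1 + 1) < ρ * a (m + 1) := hlt
      _ ≤ ρ * (ρ ^ m * a 1) := by gcongr
      _ = ρ ^ (m + 1) * a 1 := by ring
  linarith

end IsLogConvexSeq

/-! ### Powers of a symmetric matrix -/

namespace Matrix

variable {V : Type*} [Fintype V] [DecidableEq V] {N : Matrix V V ℝ}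

/-- The squared Euclidean norm of the row of `N ^ j` indexed by `x`. For symmetric `N` this is the
diagonal entry of `N ^ (2 * j)` at `x`. -/
def powRowSq (N : Matrix V V ℝ) (j : ℕ) (x : V) : ℝ := ∑ y, (N ^ j) x y ^ 2

lemma IsSymm.pow_apply_comm (hN : N.IsSymm) (j : ℕ) (x y : V) : (N ^ j) x y = (N ^ j) y x :=
  (hN.pow j).apply y x

lemma IsSymm.powRowSq_succ (hN : N.IsSymm) (j : ℕ) (x : V) :
    N.powRowSq (j + 1) x = ∑ y, (N ^ j) x y * (N ^ (j + 2)) x y := by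
  have h1 : N.powRowSq (j + 1) x = (N ^ (j + 1) * N ^ (j + 1)) x x := by
    rw [mul_apply]
    exact Finset.sum_congr rfl fun y _ ↦ by rw [hN.pow_apply_comm _ y x, sq]
  rw [h1, ← pow_add, show j + 1 + (j + 1) = j + (j + 2) by omega, pow_add, mul_apply]
  exact Finset.sum_congr rfl fun y _ ↦ by rw [hN.pow_apply_comm _ y x]

lemma IsSymm.isLogConvexSeq_powRowSq (hN : N.IsSymm) (x : V) :
    IsLogConvexSeq fun j ↦ N.powRowSq j x where
  nonneg _ := Finset.sum_nonneg fun _ _ ↦ sq_nonneg _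
  sq_le j := by
    simp only [hN.powRowSq_succ j]
    exact Finset.sum_mul_sq_le_sq_mul_sq Finset.univ ((N ^ j) x) ((N ^ (j + 2)) x)

lemma IsSymm.isLogConvexSeq_sum_powRowSq (hN : N.IsSymm) :
    IsLogConvexSeq fun j ↦ ∑ x, N.powRowSq j x where
  nonneg _ := Finset.sum_nonneg fun _ _ ↦ Finset.sum_nonneg fun _ _ ↦ sq_nonneg _
  sq_le j := by
    simp only [hN.powRowSq_succ j]
    simp only [powRowSq, ← Fintype.sum_prod_type']
    exact Finset.sum_mul_sq_le_sq_mul_sq Finset.univ (fun p : V × V ↦ (N ^ j) p.1 p.2)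
      fun p ↦ (N ^ (j + 2)) p.1 p.2

lemma IsSymm.isLogConvexSeq_mulVec (hN : N.IsSymm) (w : V → ℝ) :
    IsLogConvexSeq fun j ↦ ∑ x, ((N ^ j) *ᵥ w) x ^ 2 where
  nonneg _ := Finset.sum_nonneg fun _ _ ↦ sq_nonneg _
  sq_le j := by
    have key : ∑ x, ((N ^ (j + 1)) *ᵥ w) x ^ 2
        = ∑ x, ((N ^ j) *ᵥ w) x * ((N ^ (j + 2)) *ᵥ w) x := by
      have h1 : ((N ^ (j + 1)) *ᵥ w) ⬝ᵥ ((N ^ (j + 1)) *ᵥ w)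
          = ((N ^ j) *ᵥ w) ⬝ᵥ ((N ^ (j + 2)) *ᵥ w) := by
        rw [pow_succ' N (j + 1), pow_succ' N j, ← mulVec_mulVec w N, ← mulVec_mulVec w N,
          ← mulVec_mulVec w N, dotProduct_mulVec, ← mulVec_transpose N, hN.eq, dotProduct_comm]
      simpa [dotProduct, sq] using h1
    rw [key]
    exact Finset.sum_mul_sq_le_sq_mul_sq Finset.univ ((N ^ j) *ᵥ w) ((N ^ (j + 2)) *ᵥ w)

/-- The Frobenius norm dominates the operator norm. -/
lemma sum_mulVec_sq_le (N : Matrix V V ℝ) (j : ℕ) (w : V → ℝ) :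
    ∑ x, ((N ^ j) *ᵥ w) x ^ 2 ≤ (∑ x, N.powRowSq j x) * ∑ x, w x ^ 2 := by
  rw [Finset.sum_mul]
  exact Finset.sum_le_sum fun x _ ↦ Finset.sum_mul_sq_le_sq_mul_sq _ _ _

/-- Summed over both end points, the squares of the two parts of a walk cut at an interior vertex
`x` give `N.powRowSq (i + 1) x * N.powRowSq (j + 1) x`; by log-convexity this product is largest
when `x` is next to one of the ends. -/
lemma IsSymm.sum_sq_mul_sq_le (hN : N.IsSymm) {η : ℝ} (hη : ∀ x, N.powRowSq 1 x ≤ η) (i j : ℕ) :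
    ∑ u, ∑ v, ∑ x, ((N ^ (i + 1)) u x * (N ^ (j + 1)) x v) ^ 2
      ≤ η * ∑ x, N.powRowSq (i + j + 1) x := by
  have h1 : ∑ u, ∑ v, ∑ x, ((N ^ (i + 1)) u x * (N ^ (j + 1)) x v) ^ 2
      = ∑ x, N.powRowSq (i + 1) x * N.powRowSq (j + 1) x := by
    calc _ = ∑ u, ∑ x, ∑ v, ((N ^ (i + 1)) u x * (N ^ (j + 1)) x v) ^ 2 :=
          Finset.sum_congr rfl fun u _ ↦ Finset.sum_comm
      _ = ∑ x, ∑ u, ∑ v, ((N ^ (i + 1)) u x * (N ^ (j + 1)) x v) ^ 2 := Finset.sum_comm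
      _ = _ := Finset.sum_congr rfl fun x _ ↦ by
          rw [powRowSq, powRowSq, Finset.sum_mul_sum]
          refine Finset.sum_congr rfl fun u _ ↦ Finset.sum_congr rfl fun v _ ↦ ?_
          rw [hN.pow_apply_comm _ u x, mul_pow]
  rw [h1, Finset.mul_sum]
  refine Finset.sum_le_sum fun x _ ↦ ((hN.isLogConvexSeq_powRowSq x).mul_le_one_mul i j).trans ?_
  exact mul_le_mul_of_nonneg_right (hη x) ((hN.isLogConvexSeq_powRowSq x).nonneg _)

end Matrix

/-! ### Bilinear sums of spread-out weights over a sparse relation -/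

section Bilinear

variable {V : Type*} [Fintype V]

lemma exists_sum_mul_le_of_le (c f : V → ℝ) {M : ℝ} (hf0 : ∀ x, 0 ≤ f x) (hfM : ∀ x, f x ≤ M) :
    ∃ A : Finset V, ∑ x, f x * c x ≤ M * ∑ x ∈ A, c x := by
  classical
  refine ⟨Finset.univ.filter fun x ↦ 0 < c x, ?_⟩
  rw [Finset.sum_filter, Finset.mul_sum]
  refine Finset.sum_le_sum fun x _ ↦ ?_
  split_ifs with h
  · exact mul_le_mul_of_nonneg_right (hfM x) h.le
  · simpa using mul_nonpos_of_nonneg_of_nonpos (hf0 x) (not_lt.1 h)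

/-- A bound for the sum of a kernel over all rectangles extends to weights bounded by `M`: both
sides are affine in each of the two weights, so that the extremal weights take only the values `0`
and `M`. -/
lemma sum_sum_mul_le_of_rectangles (r : V → V → ℝ) {ε τ M : ℝ} (hM : 0 ≤ M)
    (h : ∀ A B : Finset V, ∑ x ∈ A, ∑ y ∈ B, r x y
      ≤ ε * A.card * B.card + τ * (A.card + B.card))
    {f g : V → ℝ} (hf0 : ∀ x, 0 ≤ f x) (hfM : ∀ x, f x ≤ M)
    (hg0 : ∀ x, 0 ≤ g x) (hgM : ∀ x, g x ≤ M) :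
    ∑ x, ∑ y, r x y * (f x * g y)
      ≤ ε * (∑ x, f x) * (∑ y, g y) + M * τ * (∑ x, f x + ∑ y, g y) := by
  obtain ⟨A, hA⟩ := exists_sum_mul_le_of_le
    (fun x ↦ ∑ y, (r x y - ε) * g y - M * τ) f hf0 hfM
  obtain ⟨B, hB⟩ := exists_sum_mul_le_of_le
    (fun y ↦ ∑ x ∈ A, (r x y - ε) - τ) g hg0 hgM
  have e1 : ∑ x, f x * (∑ y, (r x y - ε) * g y - M * τ)
      = ∑ x, ∑ y, r x y * (f x * g y) - ε * (∑ x, f x) * (∑ y, g y) - M * τ * ∑ x, f x := by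
    have : ∀ x, f x * (∑ y, (r x y - ε) * g y - M * τ)
        = ∑ y, r x y * (f x * g y) - ε * f x * (∑ y, g y) - M * τ * f x := fun x ↦ by
      rw [mul_sub, mul_comm (f x) (M * τ), Finset.mul_sum, Finset.mul_sum,
        ← Finset.sum_sub_distrib]
      exact congrArg (· - _) (Finset.sum_congr rfl fun y _ ↦ by ring)
    simp only [this, Finset.sum_sub_distrib, ← Finset.sum_mul, ← Finset.mul_sum]
  have e2 : ∑ x ∈ A, (∑ y, (r x y - ε) * g y - M * τ)
      = ∑ y, g y * (∑ x ∈ A, (r x y - ε) - τ) + τ * (∑ y, g y) - A.card * (M * τ) := by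
    rw [Finset.sum_sub_distrib, Finset.sum_const, nsmul_eq_mul, Finset.sum_comm, Finset.mul_sum,
      ← Finset.sum_add_distrib]
    exact congrArg (· - _) (Finset.sum_congr rfl fun y _ ↦ by rw [← Finset.sum_mul]; ring)
  have e3 : ∑ y ∈ B, (∑ x ∈ A, (r x y - ε) - τ)
      = ∑ x ∈ A, ∑ y ∈ B, r x y - ε * A.card * B.card - τ * B.card := by
    simp only [Finset.sum_sub_distrib, Finset.sum_const, nsmul_eq_mul]
    rw [Finset.sum_comm]
    ring
  rw [e1, e2] at hA
  rw [e3] at hB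
  have h1 : M * (∑ x ∈ A, ∑ y ∈ B, r x y - ε * A.card * B.card - τ * B.card)
      ≤ M * (τ * A.card) := mul_le_mul_of_nonneg_left (by linarith [h A B]) hM
  have h2 := mul_le_mul_of_nonneg_left (hB.trans h1) hM
  nlinarith [hA, h2]

/-- Two weights of total mass `W`, summed over a sparse relation. Atoms of mass above `W / L` are
paid for by the square sums, and the remaining parts are spread out enough for the sparseness to
apply. -/
lemma sum_sum_mul_le_of_sparse (r : V → V → ℝ) {ε τ L W : ℝ} (hε : 0 ≤ ε) (hτ : 0 ≤ τ) (hL : 0 < L)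
    (hr1 : ∀ x y, r x y ≤ 1)
    (h : ∀ A B : Finset V, ∑ x ∈ A, ∑ y ∈ B, r x y
      ≤ ε * A.card * B.card + τ * (A.card + B.card))
    {f g : V → ℝ} (hf0 : ∀ x, 0 ≤ f x) (hg0 : ∀ x, 0 ≤ g x)
    (hf : ∑ x, f x = W) (hg : ∑ x, g x = W) :
    ∑ x, ∑ y, r x y * (f x * g y)
      ≤ L * (∑ x, f x ^ 2 + ∑ x, g x ^ 2) + (ε + 2 * τ / L) * W ^ 2 := by
  have hW : 0 ≤ W := hf ▸ Finset.sum_nonneg fun x _ ↦ hf0 x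
  have hM : 0 ≤ W / L := by positivity
  set lt : (V → ℝ) → V → ℝ := fun f x ↦ if f x ≤ W / L then f x else 0 with hlt
  have lt0 : ∀ f : V → ℝ, (∀ x, 0 ≤ f x) → ∀ x, 0 ≤ lt f x := fun f hf x ↦ by
    simp only [hlt]; split_ifs; exacts [hf x, le_rfl]
  have ltM : ∀ (f : V → ℝ) x, lt f x ≤ W / L := fun f x ↦ by
    simp only [hlt]; split_ifs with h; exacts [h, hM]
  have ltle : ∀ f : V → ℝ, (∀ x, 0 ≤ f x) → ∀ x, lt f x ≤ f x := fun f hf x ↦ by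
    simp only [hlt]; split_ifs; exacts [le_rfl, hf x]
  have heavy : ∀ f : V → ℝ, (∀ x, 0 ≤ f x) →
      W * ∑ x, (f x - lt f x) ≤ L * ∑ x, f x ^ 2 := fun f hf ↦ by
    rw [Finset.mul_sum, Finset.mul_sum]
    refine Finset.sum_le_sum fun x _ ↦ ?_
    simp only [hlt]
    split_ifs with h
    · rw [sub_self, mul_zero]; positivity
    · have : W ≤ L * f x := by
        have := (div_lt_iff₀ hL).1 (not_le.1 h)
        linarith
      nlinarith [hf x]
  have light := sum_sum_mul_le_of_rectangles r hM h (lt0 f hf0) (ltM f) (lt0 g hg0) (ltM g)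
  have hF : ∑ x, lt f x ≤ W := hf ▸ Finset.sum_le_sum fun x _ ↦ ltle f hf0 x
  have hG : ∑ x, lt g x ≤ W := hg ▸ Finset.sum_le_sum fun x _ ↦ ltle g hg0 x
  have hF0 : 0 ≤ ∑ x, lt f x := Finset.sum_nonneg fun x _ ↦ lt0 f hf0 x
  have hG0 : 0 ≤ ∑ x, lt g x := Finset.sum_nonneg fun x _ ↦ lt0 g hg0 x
  have light' : ∑ x, ∑ y, r x y * (lt f x * lt g y) ≤ (ε + 2 * τ / L) * W ^ 2 := by
    calc _ ≤ _ := light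
      _ ≤ ε * W * W + W / L * τ * (W + W) := by gcongr
      _ = _ := by ring
  have split : ∑ x, ∑ y, r x y * (f x * g y)
      ≤ ∑ x, ∑ y, (r x y * (lt f x * lt g y) + ((f x - lt f x) * g y + f x * (g y - lt g y))) := by
    refine Finset.sum_le_sum fun x _ ↦ Finset.sum_le_sum fun y _ ↦ ?_
    have h1 : 0 ≤ (f x - lt f x) * g y := mul_nonneg (sub_nonneg.2 (ltle f hf0 x)) (hg0 y)
    have h2 : 0 ≤ lt f x * (g y - lt g y) :=
      mul_nonneg (lt0 f hf0 x) (sub_nonneg.2 (ltle g hg0 y))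
    have h3 : lt f x * (g y - lt g y) ≤ f x * (g y - lt g y) :=
      mul_le_mul_of_nonneg_right (ltle f hf0 x) (sub_nonneg.2 (ltle g hg0 y))
    nlinarith [mul_le_mul_of_nonneg_right (hr1 x y) (add_nonneg h1 h2)]
  simp only [Finset.sum_add_distrib, ← Finset.mul_sum, ← Finset.sum_mul, hf, hg] at split
  have e : ∑ x, (f x - lt f x) * W = W * ∑ x, (f x - lt f x) := by
    rw [← Finset.sum_mul, mul_comm]
  have := heavy f hf0
  have := heavy g hg0
  linarith

end Bilinear

/-! ### Weighted closed walks -/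

namespace Matrix

variable {V : Type*} (N : Matrix V V ℝ)

/-- The weight of the walk `x 0, …, x m`: the product of the entries of `N` along its steps. -/
def walkWeight {m : ℕ} (x : Fin (m + 1) → V) : ℝ := ∏ i : Fin m, N (x i.castSucc) (x i.succ)

/-- The weight of the closed walk `x`, whose indices are read modulo `m`. -/
def cycleWeight {m : ℕ} [NeZero m] (x : Fin m → V) : ℝ := ∏ i, N (x i) (x (i + 1))

lemma cycleWeight_eq_walkWeight_mul {m : ℕ} (x : Fin (m + 1) → V) :
    N.cycleWeight x = N.walkWeight x * N (x (Fin.last m)) (x 0) := by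
  simp only [cycleWeight, walkWeight, Fin.prod_univ_castSucc, Fin.coeSucc_eq_succ, Fin.last_add_one]

lemma sum_cycleWeight_rotate [Fintype V] {m : ℕ} [NeZero m] (s : Fin m) (F : (Fin m → V) → ℝ) :
    ∑ x : Fin m → V, N.cycleWeight x * F (fun i ↦ x (s + i))
      = ∑ x : Fin m → V, N.cycleWeight x * F x := by
  rw [← (Equiv.arrowCongr (Equiv.addLeft s).symm (Equiv.refl V)).sum_comp
    fun x : Fin m → V ↦ N.cycleWeight x * F x]
  refine Finset.sum_congr rfl fun x _ ↦ ?_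
  have h : (Equiv.arrowCongr (Equiv.addLeft s).symm (Equiv.refl V)) x = fun i ↦ x (s + i) := by
    funext i; simp [Equiv.arrowCongr]
  rw [h]
  congr 1
  rw [cycleWeight, cycleWeight, ← Equiv.prod_comp (Equiv.addLeft s)]
  simp [add_assoc]

variable [Fintype V] [DecidableEq V]

/-- Summing over the last `b` steps of a walk of which only the end point is observed. -/
lemma sum_walkWeight_mul (a b : ℕ) (F : (Fin (a + 1) → V) → V → ℝ) :
    ∑ x : Fin (a + b + 1) → V,
        N.walkWeight x * F (fun i ↦ x (Fin.castLE (by omega) i)) (x (Fin.last _))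
      = ∑ x : Fin (a + 1) → V, N.walkWeight x * ∑ v, (N ^ b) (x (Fin.last a)) v * F x v := by
  induction b generalizing F with
  | zero => simp [one_apply]
  | succ b ih =>
    have ih' := ih fun x z ↦ ∑ v, N z v * F x v
    have hr : ∀ x : Fin (a + 1) → V, ∑ v, (N ^ (b + 1)) (x (Fin.last a)) v * F x v
        = ∑ z, (N ^ b) (x (Fin.last a)) z * ∑ v, N z v * F x v := fun x ↦ by
      simp only [pow_succ, mul_apply, Finset.sum_mul, Finset.mul_sum]
      rw [Finset.sum_comm]
      simp only [mul_assoc]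
    simp only [hr, ← ih']
    refine ((Fin.snocEquiv fun _ : Fin (a + b + 1 + 1) ↦ V).sum_comp _).symm.trans ?_
    rw [Fintype.sum_prod_type_right]
    refine Finset.sum_congr rfl fun x _ ↦ ?_
    rw [Finset.mul_sum]
    refine Finset.sum_congr rfl fun v _ ↦ ?_
    have h1 : N.walkWeight (Fin.snocEquiv (fun _ : Fin (a + b + 1 + 1) ↦ V) (v, x))
        = N.walkWeight x * N (x (Fin.last _)) v := by
      simp only [walkWeight, Fin.snocEquiv_apply]
      rw [Fin.prod_univ_castSucc]
      simp [← Fin.castSucc_succ]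
    have h2 : (fun i : Fin (a + 1) ↦ Fin.snocEquiv (fun _ : Fin (a + b + 1 + 1) ↦ V) (v, x)
        (Fin.castLE (by omega) i)) = fun i ↦ x (Fin.castLE (by omega) i) := by
      funext i
      exact Fin.snoc_castSucc (α := fun _ ↦ V) v x (Fin.castLE (by omega) i)
    have h3 : Fin.snocEquiv (fun _ : Fin (a + b + 1 + 1) ↦ V) (v, x) (Fin.last _) = v := by
      simp
    rw [← mul_assoc, ← h1]
    exact congrArg₂ (fun y z ↦ _ * F y z) h2 h3

/-- The joint distribution of the vertices of a closed walk at positions `0`, `p`, `p + q` and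
`-1`. -/
lemma sum_cycleWeight_mul {m : ℕ} [NeZero m] (p q r : ℕ) (hm : m = 0 + p + q + r + 1)
    (Θ : V → V → V → V → ℝ) :
    ∑ x : Fin m → V,
        N.cycleWeight x * Θ (x 0) (x (Fin.ofNat m p)) (x (Fin.ofNat m (p + q))) (x (-1))
      = ∑ u, ∑ x, (N ^ p) u x * ∑ v, (N ^ q) x v * ∑ y, (N ^ r) v y * (N y u * Θ u x v y) := by
  subst hm
  have e0 := sum_walkWeight_mul N (0 + p + q) r fun z y ↦
    N y (z 0) * Θ (z 0) (z ⟨p, by omega⟩) (z (Fin.last _)) y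
  have e1 := sum_walkWeight_mul N (0 + p) q fun z v ↦ ∑ y, (N ^ r) v y *
    (N y (z 0) * Θ (z 0) (z (Fin.last _)) v y)
  have e2 := sum_walkWeight_mul N 0 p fun z x ↦ ∑ v, (N ^ q) x v * ∑ y, (N ^ r) v y *
    (N y (z 0) * Θ (z 0) x v y)
  have hl : (-1 : Fin (0 + p + q + r + 1)) = Fin.last _ :=
    (eq_neg_of_add_eq_zero_left (Fin.last_add_one _)).symm
  have hp : Fin.ofNat (0 + p + q + r + 1) p = ⟨p, by omega⟩ := by
    ext; exact Nat.mod_eq_of_lt (by omega)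
  have hq : Fin.ofNat (0 + p + q + r + 1) (p + q) = ⟨0 + p + q, by omega⟩ := by
    ext; exact (Nat.mod_eq_of_lt (by omega)).trans (congrArg (· + q) (Nat.zero_add p).symm)
  have hp' : (⟨p, by omega⟩ : Fin (0 + p + q + 1)) = Fin.castLE (by omega) (Fin.last (0 + p)) := by
    ext; simp
  rw [hl, hp, hq]
  simp only [cycleWeight_eq_walkWeight_mul, mul_assoc]
  refine e0.trans ?_
  simp only [hp']
  refine e1.trans (e2.trans ?_)
  rw [← (Equiv.funUnique (Fin 1) V).symm.sum_comp]
  refine Finset.sum_congr rfl fun u _ ↦ ?_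
  simp [walkWeight, Equiv.funUnique]

end Matrix

/-! ### Embedding bipartite graphs into dense pairs -/

/-- Greedy embedding: vertices `x i ∈ S i` with prescribed relations exist if each relation is dense
between any two subsets of sizes at least `σ i` and `σ j`. After `x 0` is chosen, every other
candidate set shrinks by a factor of at most `β`. -/
lemma exists_transversal_of_dense {V : Type*} {β : ℝ} (hβ0 : 0 < β) (hβ1 : β ≤ 1) (m : ℕ)
    (R : Fin m → Fin m → V → V → Prop) (S : Fin m → Finset V) (σ : Fin m → ℝ)
    (hσ : ∀ i, 0 < σ i) (hS : ∀ i, m * σ i ≤ β ^ m * (S i).card)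
    (h : ∀ i j, i < j → ∀ X ⊆ S i, ∀ Y ⊆ S j, σ i ≤ X.card → σ j ≤ Y.card →
      ∃ F : Finset (V × V), F ⊆ X ×ˢ Y ∧ (∀ p ∈ F, R i j p.1 p.2) ∧
        β * X.card * Y.card ≤ F.card) :
    ∃ x : Fin m → V, (∀ i, x i ∈ S i) ∧ ∀ i j, i < j → R i j (x i) (x j) := by
  classical
  induction m with
  | zero => exact ⟨fun i ↦ i.elim0, fun i ↦ i.elim0, fun i ↦ i.elim0⟩
  | succ m ih =>
    have hpow : β ^ (m + 1) ≤ 1 := pow_le_one₀ hβ0.le hβ1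
    have hσS : ∀ i, σ i ≤ (S i).card := fun i ↦ by
      have h1 := hS i
      push_cast at h1
      have h2 : β ^ (m + 1) * ((S i).card : ℝ) ≤ (S i).card :=
        mul_le_of_le_one_left (Nat.cast_nonneg _) hpow
      nlinarith [hσ i, (Nat.cast_nonneg m : (0 : ℝ) ≤ m)]
    set nbr : V → Fin m → Finset V := fun v j ↦ (S j.succ).filter fun y ↦ R 0 j.succ v y
    set bad : Fin m → Finset V := fun j ↦
      (S 0).filter fun v ↦ ((nbr v j).card : ℝ) < β * (S j.succ).card
    have hbad : ∀ j, ((bad j).card : ℝ) < σ 0 := fun j ↦ by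
      by_contra! hle
      obtain ⟨F, hF, hFR, hFc⟩ := h 0 j.succ (Fin.succ_pos j) (bad j) (Finset.filter_subset _ _)
        (S j.succ) subset_rfl hle (hσS _)
      have hne : (bad j).Nonempty := by
        rw [← Finset.card_pos]
        exact_mod_cast (hσ 0).trans_le hle
      have hsub : F ⊆ ((bad j).sigma fun v ↦ nbr v j).map
          (Equiv.sigmaEquivProd V V).toEmbedding := fun p hp ↦ by
        have h1 := Finset.mem_product.1 (hF hp)
        simp only [Finset.mem_map_equiv, Finset.mem_sigma]
        exact ⟨h1.1, Finset.mem_filter.2 ⟨h1.2, hFR p hp⟩⟩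
      have hle2 := Finset.card_le_card hsub
      rw [Finset.card_map, Finset.card_sigma] at hle2
      have h3 : (F.card : ℝ) ≤ ∑ v ∈ bad j, ((nbr v j).card : ℝ) := by exact_mod_cast hle2
      have h4 : ∑ v ∈ bad j, ((nbr v j).card : ℝ) < ∑ _v ∈ bad j, β * (S j.succ).card :=
        Finset.sum_lt_sum_of_nonempty hne fun v hv ↦ (Finset.mem_filter.1 hv).2
      rw [Finset.sum_const, nsmul_eq_mul] at h4
      linarith
    obtain ⟨v, hv, hvb⟩ : ∃ v ∈ S 0, v ∉ Finset.univ.biUnion bad := by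
      by_contra! hall
      have h1 : ((S 0).card : ℝ) ≤ ∑ j, ((bad j).card : ℝ) := by
        exact_mod_cast (Finset.card_le_card hall).trans Finset.card_biUnion_le
      have h2 : ∑ j, ((bad j).card : ℝ) ≤ m * σ 0 :=
        (Finset.sum_le_sum fun j _ ↦ (hbad j).le).trans (by simp)
      have h3 := hS 0
      push_cast at h3
      have h4 : β ^ (m + 1) * ((S 0).card : ℝ) ≤ (S 0).card :=
        mul_le_of_le_one_left (Nat.cast_nonneg _) hpow
      linarith [hσ 0]
    have hv' : ∀ j, β * (S j.succ).card ≤ (nbr v j).card := fun j ↦ by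
      by_contra! hlt
      exact hvb (Finset.mem_biUnion.2 ⟨j, Finset.mem_univ _, Finset.mem_filter.2 ⟨hv, hlt⟩⟩)
    obtain ⟨x, hx, hxR⟩ := ih (fun i j ↦ R i.succ j.succ) (nbr v) (fun i ↦ σ i.succ)
      (fun i ↦ hσ _) (fun i ↦ by
        have h1 := hS i.succ
        push_cast at h1
        calc (m : ℝ) * σ i.succ ≤ β ^ (m + 1) * (S i.succ).card := by linarith [hσ i.succ]
          _ = β ^ m * (β * (S i.succ).card) := by ring
          _ ≤ _ := by gcongr; exact hv' i)
      fun i j hij X hX Y hY ↦ h i.succ j.succ (Fin.succ_lt_succ_iff.2 hij) X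
        (hX.trans (Finset.filter_subset _ _)) Y (hY.trans (Finset.filter_subset _ _))
    refine ⟨Fin.cons v x, fun i ↦ ?_, fun i j hij ↦ ?_⟩
    · cases i using Fin.cases with
      | zero => exact hv
      | succ i => exact (Finset.mem_filter.1 (hx i)).1
    · cases j using Fin.cases with
      | zero => exact absurd hij (Fin.not_lt_zero i)
      | succ j =>
        cases i using Fin.cases with
        | zero => exact (Finset.mem_filter.1 (hx j)).2
        | succ i => exact hxR i j (Fin.succ_lt_succ_iff.1 hij)

namespace SimpleGraph

section

variable {V : Type*} (G : SimpleGraph V) [DecidableRel G.Adj]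

lemma card_interedges_le_mul_real (A B : Finset V) :
    ((G.interedges A B).card : ℝ) ≤ A.card * B.card := by
  exact_mod_cast G.card_interedges_le_mul A B

lemma card_interedges_eq_add_sdiff [DecidableEq V] {A B X Y : Finset V} (hX : X ⊆ A) (hY : Y ⊆ B) :
    (G.interedges A B).card
      = (G.interedges (A \ X) B).card + (G.interedges X (B \ Y)).card
        + (G.interedges X Y).card := by
  have h1 : (G.interedges A B).card
      = (G.interedges (A \ X) B).card + (G.interedges X B).card := by
    rw [← Finset.card_union_of_disjoint (G.interedges_disjoint_left Finset.sdiff_disjoint B)]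
    congr 1
    ext p
    simp only [mem_interedges_iff, Finset.mem_union, Finset.mem_sdiff]
    have := @hX p.1
    tauto
  have h2 : (G.interedges X B).card
      = (G.interedges X (B \ Y)).card + (G.interedges X Y).card := by
    rw [← Finset.card_union_of_disjoint (G.interedges_disjoint_right X Finset.sdiff_disjoint)]
    congr 1
    ext p
    simp only [mem_interedges_iff, Finset.mem_union, Finset.mem_sdiff]
    have := @hY p.2
    tauto
  omega

/-- A pair of density `μ` contains a subpair in which all large pairs of subsets have density at
least `μ₀ / 2`. Removing the rectangle over a sparse pair of large subsets leaves two rectangles,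
one of which is large and of density at least `μ * (1 + γ ^ 2 / 8)`; this can happen at most `k`
times before the density exceeds `1`. -/
lemma exists_lower_regular_pair {γ μ₀ : ℝ} (hγ0 : 0 < γ) (hγ1 : γ ≤ 1) (hμ₀ : 0 < μ₀)
    (hμ₁ : μ₀ ≤ 1) (k : ℕ) (μ : ℝ) (hμ : μ₀ ≤ μ) (hk : 1 < μ * (1 + γ ^ 2 / 8) ^ k)
    (A B : Finset V) (hA : A.Nonempty) (hB : B.Nonempty)
    (hAB : μ * (A.card * B.card) ≤ (G.interedges A B).card) :
    ∃ A' ⊆ A, ∃ B' ⊆ B,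
      (μ₀ * γ ^ 2 / 16) ^ k * A.card ≤ A'.card ∧ (μ₀ * γ ^ 2 / 16) ^ k * B.card ≤ B'.card ∧
      ∀ X ⊆ A', ∀ Y ⊆ B', γ * A'.card ≤ X.card → γ * B'.card ≤ Y.card →
        μ₀ / 2 * X.card * Y.card ≤ (G.interedges X Y).card := by
  classical
  have hg0 : 0 < μ₀ * γ ^ 2 / 16 := by positivity
  have hγ2 : γ ^ 2 ≤ 1 := pow_le_one₀ hγ0.le hγ1
  have hg1 : μ₀ * γ ^ 2 / 16 ≤ 1 := by nlinarith [sq_nonneg γ]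
  induction k generalizing μ A B with
  | zero =>
    have ha : (0 : ℝ) < A.card := by exact_mod_cast hA.card_pos
    have hb : (0 : ℝ) < B.card := by exact_mod_cast hB.card_pos
    have := G.card_interedges_le_mul_real A B
    rw [pow_zero, mul_one] at hk
    nlinarith [mul_pos ha hb]
  | succ k ih =>
    set g := μ₀ * γ ^ 2 / 16 with hg
    have hpow : g ^ (k + 1) ≤ 1 := pow_le_one₀ hg0.le hg1
    by_cases hreg : ∀ X ⊆ A, ∀ Y ⊆ B, γ * A.card ≤ X.card → γ * B.card ≤ Y.card →
        μ₀ / 2 * X.card * Y.card ≤ (G.interedges X Y).card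
    · exact ⟨A, subset_rfl, B, subset_rfl, mul_le_of_le_one_left (Nat.cast_nonneg _) hpow,
        mul_le_of_le_one_left (Nat.cast_nonneg _) hpow, hreg⟩
    push Not at hreg
    obtain ⟨X, hX, Y, hY, hXc, hYc, hXY⟩ := hreg
    have hsplit : ((G.interedges A B).card : ℝ)
        = (G.interedges (A \ X) B).card + (G.interedges X (B \ Y)).card
          + (G.interedges X Y).card := by
      exact_mod_cast G.card_interedges_eq_add_sdiff hX hY
    have hcA : ((A \ X).card : ℝ) = A.card - X.card := Finset.cast_card_sdiff hX
    have hcB : ((B \ Y).card : ℝ) = B.card - Y.card := Finset.cast_card_sdiff hY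
    have e1 := G.card_interedges_le_mul_real (A \ X) B
    have e2 := G.card_interedges_le_mul_real X (B \ Y)
    have ha : (0 : ℝ) < A.card := by exact_mod_cast hA.card_pos
    have hb : (0 : ℝ) < B.card := by exact_mod_cast hB.card_pos
    have hxa : (X.card : ℝ) ≤ A.card := by exact_mod_cast Finset.card_le_card hX
    have hyb : (Y.card : ℝ) ≤ B.card := by exact_mod_cast Finset.card_le_card hY
    have hpowk : 0 < g ^ k := pow_pos hg0 k
    have hμ' : μ₀ ≤ μ * (1 + γ ^ 2 / 8) := by nlinarith [sq_nonneg γ]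
    have hk' : 1 < μ * (1 + γ ^ 2 / 8) * (1 + γ ^ 2 / 8) ^ k := by
      rwa [mul_assoc, ← pow_succ']
    have hgγ : g ≤ γ := by nlinarith [mul_pos hμ₀ hγ0]
    by_cases c1 : g * A.card ≤ (A \ X).card ∧
        μ * (1 + γ ^ 2 / 8) * ((A \ X).card * B.card) ≤ (G.interedges (A \ X) B).card
    · have hne : (A \ X).Nonempty := by
        rw [← Finset.card_pos]
        exact_mod_cast (mul_pos hg0 ha).trans_le c1.1
      obtain ⟨A', hA', B', hB', h1, h2, h3⟩ := ih _ hμ' hk' (A \ X) B hne hB c1.2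
      refine ⟨A', hA'.trans Finset.sdiff_subset, B', hB', ?_, ?_, h3⟩
      · calc g ^ (k + 1) * A.card = g ^ k * (g * A.card) := by ring
          _ ≤ g ^ k * (A \ X).card := by gcongr; exact c1.1
          _ ≤ _ := h1
      · calc g ^ (k + 1) * (B.card : ℝ) = g * (g ^ k * B.card) := by ring
          _ ≤ g ^ k * B.card := mul_le_of_le_one_left (by positivity) hg1
          _ ≤ _ := h2
    by_cases c2 : g * B.card ≤ (B \ Y).card ∧
        μ * (1 + γ ^ 2 / 8) * (X.card * (B \ Y).card) ≤ (G.interedges X (B \ Y)).card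
    · have hXg : g * A.card ≤ X.card := le_trans (by gcongr) hXc
      have hXne : X.Nonempty := by
        rw [← Finset.card_pos]
        exact_mod_cast (mul_pos hg0 ha).trans_le hXg
      have hne : (B \ Y).Nonempty := by
        rw [← Finset.card_pos]
        exact_mod_cast (mul_pos hg0 hb).trans_le c2.1
      obtain ⟨A', hA', B', hB', h1, h2, h3⟩ := ih _ hμ' hk' X (B \ Y) hXne hne c2.2
      refine ⟨A', hA'.trans hX, B', hB'.trans Finset.sdiff_subset, ?_, ?_, h3⟩
      · calc g ^ (k + 1) * A.card = g ^ k * (g * A.card) := by ring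
          _ ≤ g ^ k * X.card := by gcongr
          _ ≤ _ := h1
      · calc g ^ (k + 1) * (B.card : ℝ) = g ^ k * (g * B.card) := by ring
          _ ≤ g ^ k * (B \ Y).card := by gcongr; exact c2.1
          _ ≤ _ := h2
    exfalso
    have hμ0 : 0 < μ := hμ₀.trans_le hμ
    have f1 : ((G.interedges (A \ X) B).card : ℝ)
        ≤ μ * (1 + γ ^ 2 / 8) * ((A.card - X.card) * B.card) + g * (A.card * B.card) := by
      rw [← hcA]
      have p1 : 0 ≤ μ * (1 + γ ^ 2 / 8) * (((A \ X).card : ℝ) * B.card) := by positivity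
      have p2 : 0 ≤ g * ((A.card : ℝ) * B.card) := by positivity
      by_cases hs : g * A.card ≤ (A \ X).card
      · have := not_le.1 fun hh ↦ c1 ⟨hs, hh⟩
        linarith
      · have := mul_le_mul_of_nonneg_right (not_le.1 hs).le hb.le
        linarith
    have f2 : ((G.interedges X (B \ Y)).card : ℝ)
        ≤ μ * (1 + γ ^ 2 / 8) * (X.card * (B.card - Y.card)) + g * (A.card * B.card) := by
      rw [← hcB]
      have p1 : 0 ≤ μ * (1 + γ ^ 2 / 8) * ((X.card : ℝ) * (B \ Y).card) := by positivity
      have p2 : 0 ≤ g * ((A.card : ℝ) * B.card) := by positivity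
      by_cases hs : g * B.card ≤ (B \ Y).card
      · have := not_le.1 fun hh ↦ c2 ⟨hs, hh⟩
        linarith
      · have h1 := mul_le_mul hxa (not_le.1 hs).le (Nat.cast_nonneg _) ha.le
        linarith
    have hxy : γ ^ 2 * ((A.card : ℝ) * B.card) ≤ X.card * Y.card := by
      calc γ ^ 2 * ((A.card : ℝ) * B.card) = (γ * A.card) * (γ * B.card) := by ring
        _ ≤ _ := mul_le_mul hXc hYc (by positivity) (Nat.cast_nonneg _)
    have f3 : ((G.interedges X Y).card : ℝ) ≤ μ / 2 * (X.card * Y.card) := by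
      have : μ₀ / 2 * ((X.card : ℝ) * Y.card) ≤ μ / 2 * (X.card * Y.card) := by gcongr
      linarith
    set P := (A.card : ℝ) * B.card with hP
    set Q := (X.card : ℝ) * Y.card with hQ
    have hP0 : 0 < P := mul_pos ha hb
    have key : μ * P ≤ μ * (1 + γ ^ 2 / 8) * (P - Q) + 2 * g * P + μ / 2 * Q := by
      have : μ * (1 + γ ^ 2 / 8) * ((A.card - X.card) * B.card)
          + μ * (1 + γ ^ 2 / 8) * (X.card * (B.card - Y.card))
          = μ * (1 + γ ^ 2 / 8) * (P - Q) := by rw [hP, hQ]; ring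
      linarith
    have hgP : g * P ≤ μ * γ ^ 2 / 16 * P := by
      rw [hg]; gcongr
    have hQ1 : μ * (γ ^ 2 * P) ≤ μ * Q := by gcongr
    have hpos : 0 < μ * (γ ^ 2 * P) := by positivity
    have hQ2 : 0 ≤ μ * (γ ^ 2 * Q) := by positivity
    linarith

end

/-- An induced copy is the same as a map that sends edges to edges, and distinct non-adjacent
vertices to distinct non-adjacent vertices. -/
lemma IsIndContained.of_map {V W : Type*} {G : SimpleGraph V} {H : SimpleGraph W} (x : W → V)
    (hadj : ∀ i j, H.Adj i j → G.Adj (x i) (x j))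
    (hnadj : ∀ i j, i ≠ j → ¬ H.Adj i j → ¬ G.Adj (x i) (x j) ∧ x i ≠ x j) :
    H.IsIndContained G := by
  have hinj : Function.Injective x := fun i j hij ↦ by
    by_contra hne
    by_cases h : H.Adj i j
    · exact (hadj i j h).ne hij
    · exact (hnadj i j hne h).2 hij
  refine ⟨⟨⟨x, hinj⟩, fun {i j} ↦ ⟨fun h ↦ ?_, hadj i j⟩⟩⟩
  by_contra hn
  exact (hnadj i j (fun hij ↦ G.loopless.irrefl _ (hij ▸ h)) hn).1 h

/-- A dense pair of sets of size at least a large multiple of `t` in a `(c, t)`-sparse graph contains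
an induced copy of any given bipartite graph. -/
theorem exists_forall_isIndContained_of_dense_pair {c ε : ℝ} (hc : 0 < c) (hc1 : c ≤ 1)
    (hε : 0 < ε) (hε1 : ε ≤ 1) {m : ℕ} (H : SimpleGraph (Fin m)) (C : H.Coloring Bool) :
    ∃ K : ℝ, 1 ≤ K ∧ ∀ {V : Type*} (G : SimpleGraph V) [DecidableRel G.Adj] (t : ℝ), 1 ≤ t →
      G.IsLocallySparse c t → ∀ A B : Finset V, K * t ≤ A.card → K * t ≤ B.card →
      ε * (A.card * B.card) < (G.interedges A B).card → H.IsIndContained G := by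
  set β := min (c / 2) (ε / 2) with hβ
  have hβ0 : 0 < β := lt_min (by positivity) (by positivity)
  have hβ1 : β ≤ 1 := (min_le_left _ _).trans (by linarith)
  set γ := β ^ m / (m + 1) with hγ
  have hm0 : (0 : ℝ) ≤ m := Nat.cast_nonneg m
  have hγ0 : 0 < γ := by positivity
  have hγ1 : γ ≤ 1 := by
    rw [hγ, div_le_one (by positivity)]
    exact (pow_le_one₀ hβ0.le hβ1).trans (by linarith)
  obtain ⟨k, hk⟩ := pow_unbounded_of_one_lt (1 / ε)
    (show 1 < 1 + γ ^ 2 / 8 by have : 0 < γ ^ 2 / 8 := by positivity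
                               linarith)
  rw [div_lt_iff₀' hε] at hk
  set g := (ε * γ ^ 2 / 16) ^ k with hg
  have hg0 : 0 < g := by positivity
  have hg1 : g ≤ 1 := pow_le_one₀ (by positivity) (by nlinarith [pow_le_one₀ (n := 2) hγ0.le hγ1])
  have h2c : 1 ≤ 2 / c := by rw [le_div_iff₀ hc]; linarith
  refine ⟨2 / c / (γ * g), ?_, fun {V} G _ t ht hG A B hA hB hAB ↦ ?_⟩
  · rw [le_div_iff₀ (by positivity), one_mul]
    exact (mul_le_one₀ hγ1 hg0.le hg1).trans h2c
  classical
  have hKt : 0 < 2 / c / (γ * g) * t := by positivity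
  obtain ⟨A', -, B', -, hA', hB', hreg⟩ := G.exists_lower_regular_pair hγ0 hγ1 hε hε1 k ε le_rfl hk
    A B (Finset.card_pos.1 (by exact_mod_cast hKt.trans_le hA))
    (Finset.card_pos.1 (by exact_mod_cast hKt.trans_le hB)) hAB.le
  have hlarge : ∀ D D' : Finset V, 2 / c / (γ * g) * t ≤ D.card → g * D.card ≤ D'.card →
      2 / c * t ≤ γ * D'.card := fun D D' h1 h2 ↦ by
    calc 2 / c * t = γ * (g * (2 / c / (γ * g) * t)) := by field_simp
      _ ≤ γ * (g * D.card) := by gcongr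
      _ ≤ _ := by gcongr
  set S : Fin m → Finset V := fun i ↦ if C i then A' else B' with hS
  have hSl : ∀ i, 2 / c * t ≤ γ * (S i).card := fun i ↦ by
    simp only [hS]
    split_ifs
    exacts [hlarge A A' hA hA', hlarge B B' hB hB']
  have h2ct : 0 < 2 / c * t := by positivity
  obtain ⟨x, -, hx⟩ := exists_transversal_of_dense hβ0 hβ1 m
    (fun i j v w ↦ if H.Adj i j then G.Adj v w else ¬ G.Adj v w ∧ v ≠ w) S
    (fun i ↦ γ * (S i).card) (fun i ↦ h2ct.trans_le (hSl i)) (fun i ↦ by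
      rw [hγ, ← mul_assoc]
      gcongr
      rw [mul_div_left_comm]
      exact mul_le_of_le_one_right (by positivity) (by rw [div_le_one] <;> linarith))
    fun i j _ X hX Y hY hXc hYc ↦ by
      by_cases hij : H.Adj i j
      · refine ⟨G.interedges X Y, Finset.filter_subset _ _, fun p hp ↦ ?_, ?_⟩
        · rw [if_pos hij]
          exact (G.mem_interedges_iff.1 hp).2.2
        · have hval : C i ≠ C j := C.valid hij
          have hβε : β * X.card * Y.card ≤ ε / 2 * X.card * Y.card :=
            mul_le_mul_of_nonneg_right (mul_le_mul_of_nonneg_right (min_le_right _ _)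
              (Nat.cast_nonneg _)) (Nat.cast_nonneg _)
          refine hβε.trans ?_
          rcases hi : C i with _ | _ <;> rcases hj : C j with _ | _
          · exact absurd (hi.trans hj.symm) hval
          · rw [show S i = B' by simp [hS, hi]] at hX hXc
            rw [show S j = A' by simp [hS, hj]] at hY hYc
            have h1 := hreg Y hY X hX hYc hXc
            have : Std.Symm G.Adj := ⟨fun _ _ h ↦ h.symm⟩
            have h2 : (G.interedges X Y).card = (G.interedges Y X).card :=
              Rel.card_interedges_comm X Y
            rw [h2]
            linarith
          · rw [show S i = A' by simp [hS, hi]] at hX hXc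
            rw [show S j = B' by simp [hS, hj]] at hY hYc
            exact hreg X hX Y hY hXc hYc
          · exact absurd (hi.trans hj.symm) hval
      · -- Sparseness bounds the adjacent pairs, and there are at most `|X|` pairs of equal vertices.
        have hXt := (hSl i).trans hXc
        have hYt := (hSl j).trans hYc
        have h1 : t ≤ 2 / c * t := le_mul_of_one_le_left (by linarith) h2c
        have hsp := hG X Y (h1.trans hXt) (h1.trans hYt)
        refine ⟨((X ×ˢ Y) \ G.interedges X Y) \ X.image fun v ↦ (v, v), ?_, fun p hp ↦ ?_, ?_⟩
        · exact Finset.sdiff_subset.trans Finset.sdiff_subset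
        · simp only [Finset.mem_sdiff, mem_interedges_iff, Finset.mem_product, Finset.mem_image,
            not_and, not_exists] at hp
          simp only [hij, if_false]
          exact ⟨hp.1.2 hp.1.1.1 hp.1.1.2, fun he ↦ hp.2 p.1 hp.1.1.1 (Prod.ext rfl he)⟩
        · have hc1 := Finset.le_card_sdiff (X.image fun v ↦ (v, v)) ((X ×ˢ Y) \ G.interedges X Y)
          have hc2 : (X.image fun v ↦ (v, v)).card ≤ X.card := Finset.card_image_le
          have hc3 : ((X ×ˢ Y) \ G.interedges X Y).card + (G.interedges X Y).card
              = X.card * Y.card := by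
            rw [← Finset.card_product]
            exact Finset.card_sdiff_add_card_eq_card (Finset.filter_subset _ _)
          have hc4 : (X.card : ℝ) * Y.card ≤
              (((X ×ˢ Y) \ G.interedges X Y) \ X.image fun v ↦ (v, v)).card + X.card
                + (G.interedges X Y).card := by
            exact_mod_cast (by omega : X.card * Y.card ≤ _)
          have hY2 : 2 / c ≤ Y.card := le_trans (le_mul_of_one_le_right (by positivity) ht) hYt
          have hY3 : (X.card : ℝ) ≤ c / 2 * X.card * Y.card := by
            rw [div_le_iff₀ hc] at hY2
            nlinarith [(Nat.cast_nonneg X.card : (0 : ℝ) ≤ X.card)]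
          have hβc : β * X.card * Y.card ≤ c / 2 * X.card * Y.card :=
            mul_le_mul_of_nonneg_right (mul_le_mul_of_nonneg_right (min_le_left _ _)
              (Nat.cast_nonneg _)) (Nat.cast_nonneg _)
          linarith
  have hx' : ∀ i j, i ≠ j → if H.Adj i j then G.Adj (x i) (x j)
      else ¬ G.Adj (x i) (x j) ∧ x i ≠ x j := fun i j hij ↦ by
    rcases lt_or_gt_of_ne hij with h | h
    · exact hx i j h
    · have hji := hx j i h
      split_ifs with hH
      · rw [if_pos hH.symm] at hji
        exact hji.symm
      · rw [if_neg fun hH' ↦ hH hH'.symm] at hji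
        exact ⟨fun hG' ↦ hji.1 hG'.symm, hji.2.symm⟩
  refine IsIndContained.of_map x (fun i j h ↦ ?_) fun i j hij h ↦ ?_
  · exact (if_pos h).mp (hx' i j h.ne)
  · exact (if_neg h).mp (hx' i j hij)

end SimpleGraph

/-! ### Closed walks without conflicts -/

namespace Matrix

variable {V : Type*} [Fintype V] [DecidableEq V] {N : Matrix V V ℝ}

lemma IsSymm.sum_cycleWeight (hN : N.IsSymm) (ℓ : ℕ) [NeZero (2 * ℓ)] :
    ∑ x : Fin (2 * ℓ) → V, N.cycleWeight x = ∑ x, N.powRowSq ℓ x := by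
  have hℓ : ℓ ≠ 0 := by have := NeZero.ne (2 * ℓ); omega
  have h := N.sum_cycleWeight_mul (m := 2 * ℓ) 0 ℓ (ℓ - 1) (by omega) fun _ _ _ _ ↦ 1
  simp only [mul_one, ← mul_apply, ← pow_succ, Nat.sub_add_cancel (Nat.pos_of_ne_zero hℓ)] at h
  rw [h]
  refine Finset.sum_congr rfl fun u _ ↦ ?_
  rw [pow_zero, one_mul, mul_apply, powRowSq]
  exact Finset.sum_congr rfl fun v _ ↦ by rw [hN.pow_apply_comm ℓ v u, sq]

/-- The weight of the closed walks whose vertices at positions `s - 1` and `s + i + 1` are related,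
for a sparse relation. The walk is cut at the antipodal positions `s` and `s + i + j + 2`, which
separate these two positions, so that given the vertices at the cuts the two related vertices are
independent. -/
lemma IsSymm.sum_cycleWeight_mul_le (hN : N.IsSymm) (h0 : ∀ x y, 0 ≤ N x y) {η ε τ L : ℝ}
    (hη : ∀ x, N.powRowSq 1 x ≤ η) (hε : 0 ≤ ε) (hτ : 0 ≤ τ) (hL : 0 < L) (r : V → V → ℝ)
    (hr1 : ∀ x y, r x y ≤ 1)
    (h : ∀ A B : Finset V, ∑ x ∈ A, ∑ y ∈ B, r x y
      ≤ ε * A.card * B.card + τ * (A.card + B.card))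
    (i j : ℕ) {m : ℕ} [NeZero m] (hm : m = 2 * (i + j + 2)) (s : Fin m) :
    ∑ x : Fin m → V, N.cycleWeight x * r (x (s + Fin.ofNat m (i + 1))) (x (s + -1))
      ≤ L * (2 * (η * ∑ x, N.powRowSq (i + j + 1) x))
        + (ε + 2 * τ / L) * ∑ x, N.powRowSq (i + j + 2) x := by
  rw [N.sum_cycleWeight_rotate s fun x ↦ r (x (Fin.ofNat m (i + 1))) (x (-1)),
    N.sum_cycleWeight_mul (i + 1) (j + 1) (i + j + 1) (by omega) fun _ x _ y ↦ r x y]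
  set f : V → V → V → ℝ := fun u v x ↦ (N ^ (i + 1)) u x * (N ^ (j + 1)) x v with hf
  set g : V → V → V → ℝ := fun u v y ↦ (N ^ (0 + 1)) u y * (N ^ (i + j + 1)) y v with hg
  have hsum : ∀ u, ∑ x, (N ^ (i + 1)) u x * ∑ v, (N ^ (j + 1)) x v *
      ∑ y, (N ^ (i + j + 1)) v y * (N y u * r x y)
      = ∑ v, ∑ x, ∑ y, r x y * (f u v x * g u v y) := fun u ↦ by
    rw [Finset.sum_comm]
    refine Finset.sum_congr rfl fun x _ ↦ ?_
    rw [Finset.mul_sum]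
    refine Finset.sum_congr rfl fun v _ ↦ ?_
    rw [Finset.mul_sum, Finset.mul_sum]
    refine Finset.sum_congr rfl fun y _ ↦ ?_
    rw [hf, hg]
    simp only
    rw [zero_add, pow_one, hN.pow_apply_comm _ v y, hN.apply u y]
    ring
  have hbound : ∀ u v, ∑ x, ∑ y, r x y * (f u v x * g u v y)
      ≤ L * (∑ x, f u v x ^ 2 + ∑ x, g u v x ^ 2)
        + (ε + 2 * τ / L) * (N ^ (i + j + 2)) u v ^ 2 := fun u v ↦ by
    refine sum_sum_mul_le_of_sparse r hε hτ hL hr1 h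
      (fun x ↦ mul_nonneg (pow_apply_nonneg h0 _ _ _) (pow_apply_nonneg h0 _ _ _))
      (fun x ↦ mul_nonneg (pow_apply_nonneg h0 _ _ _) (pow_apply_nonneg h0 _ _ _)) ?_ ?_
    · rw [← mul_apply, ← pow_add, show i + 1 + (j + 1) = i + j + 2 by omega]
    · rw [← mul_apply, ← pow_add, show 0 + 1 + (i + j + 1) = i + j + 2 by omega]
  simp only [hsum]
  calc _ ≤ ∑ u, ∑ v, (L * (∑ x, f u v x ^ 2 + ∑ x, g u v x ^ 2)
        + (ε + 2 * τ / L) * (N ^ (i + j + 2)) u v ^ 2) :=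
      Finset.sum_le_sum fun u _ ↦ Finset.sum_le_sum fun v _ ↦ hbound u v
    _ = L * (∑ u, ∑ v, ∑ x, f u v x ^ 2 + ∑ u, ∑ v, ∑ x, g u v x ^ 2)
        + (ε + 2 * τ / L) * ∑ x, N.powRowSq (i + j + 2) x := by
      simp only [Finset.sum_add_distrib, ← Finset.mul_sum, powRowSq]
    _ ≤ _ := by
      have h1 := hN.sum_sq_mul_sq_le hη i j
      have h2 := hN.sum_sq_mul_sq_le hη 0 (i + j)
      rw [zero_add (i + j)] at h2
      have := add_le_add h1 h2
      gcongr
      linarith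

/-- A union bound: some closed walk of positive weight has no related pair of vertices at cyclic
distance at least two. -/
lemma IsSymm.exists_cycleWeight_pos (hN : N.IsSymm) (h0 : ∀ x y, 0 ≤ N x y) {η ε τ L : ℝ}
    (hη : ∀ x, N.powRowSq 1 x ≤ η) (hε : 0 ≤ ε) (hτ : 0 ≤ τ) (hL : 0 < L)
    (R : V → V → Prop) [DecidableRel R]
    (h : ∀ A B : Finset V, ∑ x ∈ A, ∑ y ∈ B, (if R x y then 1 else 0 : ℝ)
      ≤ ε * A.card * B.card + τ * (A.card + B.card))
    {ℓ : ℕ} (hℓ : 2 ≤ ℓ) [NeZero (2 * ℓ)]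
    (hlt : 2 * ℓ ^ 2 * (L * (2 * (η * ∑ x, N.powRowSq (ℓ - 1) x))
        + (ε + 2 * τ / L) * ∑ x, N.powRowSq ℓ x) < ∑ x, N.powRowSq ℓ x) :
    ∃ x : Fin (2 * ℓ) → V, 0 < N.cycleWeight x ∧
      ∀ (s : Fin (2 * ℓ)) (k : ℕ), 1 ≤ k → k < ℓ →
        ¬ R (x (s + Fin.ofNat (2 * ℓ) k)) (x (s + -1)) := by
  by_contra! hcon
  set r : V → V → ℝ := fun x y ↦ if R x y then 1 else 0 with hr
  have hr0 : ∀ x y, 0 ≤ r x y := fun x y ↦ by simp only [hr]; split_ifs <;> norm_num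
  have hr1 : ∀ x y, r x y ≤ 1 := fun x y ↦ by simp only [hr]; split_ifs <;> norm_num
  set T := L * (2 * (η * ∑ x, N.powRowSq (ℓ - 1) x))
        + (ε + 2 * τ / L) * ∑ x, N.powRowSq ℓ x with hT
  have hw0 : ∀ x : Fin (2 * ℓ) → V, 0 ≤ N.cycleWeight x :=
    fun x ↦ Finset.prod_nonneg fun i _ ↦ h0 _ _
  have hpt : ∀ x : Fin (2 * ℓ) → V, N.cycleWeight x ≤ ∑ s : Fin (2 * ℓ), ∑ i ∈ Finset.range (ℓ - 1),
      N.cycleWeight x * r (x (s + Fin.ofNat (2 * ℓ) (i + 1))) (x (s + -1)) := fun x ↦ by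
    have hterm : ∀ (s : Fin (2 * ℓ)) (i : ℕ), 0 ≤
        N.cycleWeight x * r (x (s + Fin.ofNat (2 * ℓ) (i + 1))) (x (s + -1)) :=
      fun s i ↦ mul_nonneg (hw0 x) (hr0 _ _)
    rcases (hw0 x).eq_or_lt with hx | hx
    · rw [← hx]
      exact Finset.sum_nonneg fun s _ ↦ Finset.sum_nonneg fun i _ ↦ hx ▸ hterm s i
    · obtain ⟨s, k, hk1, hk2, hR⟩ := hcon x hx
      calc N.cycleWeight x
          = N.cycleWeight x * r (x (s + Fin.ofNat (2 * ℓ) (k - 1 + 1))) (x (s + -1)) := by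
            rw [Nat.sub_add_cancel hk1]; simp only [hr, if_pos hR, mul_one]
        _ ≤ ∑ i ∈ Finset.range (ℓ - 1),
            N.cycleWeight x * r (x (s + Fin.ofNat (2 * ℓ) (i + 1))) (x (s + -1)) :=
          Finset.single_le_sum
            (f := fun i ↦ N.cycleWeight x * r (x (s + Fin.ofNat (2 * ℓ) (i + 1))) (x (s + -1)))
            (fun i _ ↦ hterm s i) (Finset.mem_range.2 (by omega))
        _ ≤ _ := Finset.single_le_sum (f := fun s ↦ ∑ i ∈ Finset.range (ℓ - 1),
            N.cycleWeight x * r (x (s + Fin.ofNat (2 * ℓ) (i + 1))) (x (s + -1)))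
            (fun s _ ↦ Finset.sum_nonneg fun i _ ↦ hterm s i) (Finset.mem_univ s)
  have hsi : ∀ (s : Fin (2 * ℓ)), ∀ i ∈ Finset.range (ℓ - 1), ∑ x : Fin (2 * ℓ) → V,
      N.cycleWeight x * r (x (s + Fin.ofNat (2 * ℓ) (i + 1))) (x (s + -1)) ≤ T := fun s i hi ↦ by
    have hi' := Finset.mem_range.1 hi
    have := hN.sum_cycleWeight_mul_le h0 hη hε hτ hL r hr1 h i (ℓ - 2 - i) (m := 2 * ℓ) (by omega) s
    rwa [show i + (ℓ - 2 - i) + 1 = ℓ - 1 by omega, show i + (ℓ - 2 - i) + 2 = ℓ by omega] at this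
  have hT0 : 0 ≤ T := by
    refine le_trans (Finset.sum_nonneg fun x _ ↦ mul_nonneg (hw0 x) (hr0 _ _))
      (hsi 0 0 (Finset.mem_range.2 (by omega)))
  have htotal : ∑ x, N.powRowSq ℓ x ≤ 2 * ℓ ^ 2 * T := by
    rw [← hN.sum_cycleWeight ℓ]
    calc _ ≤ ∑ x : Fin (2 * ℓ) → V, ∑ s : Fin (2 * ℓ), ∑ i ∈ Finset.range (ℓ - 1),
          N.cycleWeight x * r (x (s + Fin.ofNat (2 * ℓ) (i + 1))) (x (s + -1)) :=
        Finset.sum_le_sum fun x _ ↦ hpt x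
      _ = ∑ s : Fin (2 * ℓ), ∑ i ∈ Finset.range (ℓ - 1), ∑ x : Fin (2 * ℓ) → V,
          N.cycleWeight x * r (x (s + Fin.ofNat (2 * ℓ) (i + 1))) (x (s + -1)) := by
        rw [Finset.sum_comm]
        exact Finset.sum_congr rfl fun s _ ↦ Finset.sum_comm
      _ ≤ ∑ s : Fin (2 * ℓ), ∑ i ∈ Finset.range (ℓ - 1), T :=
        Finset.sum_le_sum fun s _ ↦ Finset.sum_le_sum fun i hi ↦ hsi s i hi
      _ = 2 * ℓ * (ℓ - 1 : ℕ) * T := by simp; ring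
      _ ≤ 2 * ℓ * ℓ * T := by gcongr; omega
      _ = _ := by ring
  linarith

end Matrix

namespace SimpleGraph

lemma cycleGraph_isIndContained_of_closedWalk {V : Type*} {G : SimpleGraph V} {ℓ : ℕ} (hℓ : 2 ≤ ℓ)
    [NeZero (2 * ℓ)] (x : Fin (2 * ℓ) → V) (hadj : ∀ i, G.Adj (x i) (x (i + 1)))
    (hfar : ∀ (s : Fin (2 * ℓ)) (k : ℕ), 1 ≤ k → k < ℓ →
      ¬ (G.Adj (x (s + Fin.ofNat (2 * ℓ) k)) (x (s + -1)) ∨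
        x (s + Fin.ofNat (2 * ℓ) k) = x (s + -1))) :
    (cycleGraph (2 * ℓ)).IsIndContained G := by
  have hcyc : ∀ i j : Fin (2 * ℓ), (cycleGraph (2 * ℓ)).Adj i j ↔ i = j + 1 ∨ j = i + 1 := by
    obtain ⟨n, hn⟩ : ∃ n, 2 * ℓ = n + 2 := ⟨2 * ℓ - 2, by omega⟩
    clear hfar hadj x
    revert ‹NeZero (2 * ℓ)›
    rw [hn]
    intro _ i j
    rw [cycleGraph_adj, sub_eq_iff_eq_add', sub_eq_iff_eq_add', add_comm j 1, add_comm i 1]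
  have hofNat : ∀ a b, Fin.ofNat (2 * ℓ) (a + b) = Fin.ofNat (2 * ℓ) a + Fin.ofNat (2 * ℓ) b :=
    fun a b ↦ by ext; simp [Fin.ofNat, Fin.val_add, Nat.add_mod]
  have hone : Fin.ofNat (2 * ℓ) 1 = 1 := rfl
  have hclose : ∀ (i : Fin (2 * ℓ)) (d : ℕ), 2 ≤ d → d ≤ ℓ →
      ¬ G.Adj (x i) (x (i + Fin.ofNat (2 * ℓ) d)) ∧ x i ≠ x (i + Fin.ofNat (2 * ℓ) d) := by
    intro i d h2 hd
    have h := hfar (i + 1) (d - 1) (by omega) (by omega)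
    have e : i + 1 + Fin.ofNat (2 * ℓ) (d - 1) = i + Fin.ofNat (2 * ℓ) d := by
      rw [add_assoc, ← hone, ← hofNat]
      congr 2; omega
    rw [e, add_neg_cancel_right, not_or] at h
    exact ⟨fun h' ↦ h.1 h'.symm, fun h' ↦ h.2 h'.symm⟩
  refine IsIndContained.of_map x (fun i j h ↦ ?_) fun i j hij h ↦ ?_
  · rcases (hcyc i j).1 h with rfl | rfl
    exacts [(hadj j).symm, hadj i]
  · rw [hcyc, not_or] at h
    set d := (j - i).val with hd
    have hdlt : d < 2 * ℓ := (j - i).isLt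
    have hj : j = i + Fin.ofNat (2 * ℓ) d := by
      rw [hd, Fin.ofNat_val_eq_self, add_sub_cancel]
    have hi : i = j + Fin.ofNat (2 * ℓ) (2 * ℓ - d) := by
      rw [hj, add_assoc, ← hofNat, Nat.add_sub_cancel' hdlt.le]
      simp [Fin.ofNat]
    have hd0 : d ≠ 0 := fun h0 ↦ hij (by rw [hj, h0]; simp [Fin.ofNat])
    have hd1 : d ≠ 1 := fun h1 ↦ h.2 (by rw [hj, h1, hone])
    have hd2 : 2 * ℓ - d ≠ 1 := fun h1 ↦ h.1 (by rw [h1, hone] at hi; exact hi)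
    rcases le_or_gt d ℓ with hle | hgt
    · have := hclose i d (by omega) hle
      rwa [← hj] at this
    · have := hclose j (2 * ℓ - d) (by omega) (by omega)
      rw [← hi] at this
      exact ⟨fun h' ↦ this.1 h'.symm, this.2.symm⟩

end SimpleGraph

namespace SimpleGraph

/-! ### Sparseness of the conflict relation -/

section

variable {V : Type*} {G : SimpleGraph V} [DecidableRel G.Adj]

lemma sum_sum_adj_or_eq_le [DecidableEq V] (A B : Finset V) {ε s : ℝ} (hε : 0 ≤ ε) (hs : 0 ≤ s)
    (h : s ≤ A.card → s ≤ B.card → ((G.interedges A B).card : ℝ) ≤ ε * (A.card * B.card)) :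
    ∑ x ∈ A, ∑ y ∈ B, (if G.Adj x y ∨ x = y then 1 else 0 : ℝ)
      ≤ ε * A.card * B.card + (s + 1) * (A.card + B.card) := by
  have hA : (0 : ℝ) ≤ A.card := Nat.cast_nonneg _
  have hB : (0 : ℝ) ≤ B.card := Nat.cast_nonneg _
  have h1 : ∑ x ∈ A, ∑ y ∈ B, (if G.Adj x y then 1 else 0 : ℝ) = (G.interedges A B).card := by
    rw [interedges_def, Finset.card_filter, Finset.sum_product]
    push_cast
    rfl
  have h2 : ∑ x ∈ A, ∑ y ∈ B, (if x = y then 1 else 0 : ℝ) ≤ A.card := by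
    calc _ ≤ ∑ x ∈ A, (1 : ℝ) := Finset.sum_le_sum fun x _ ↦ by
          rw [Finset.sum_ite_eq]; split_ifs <;> norm_num
      _ = A.card := by simp
  have h3 : ((G.interedges A B).card : ℝ) ≤ ε * A.card * B.card + s * (A.card + B.card) := by
    have he := G.card_interedges_le_mul_real A B
    have p1 : 0 ≤ ε * A.card * B.card := by positivity
    have p2 : 0 ≤ s * A.card := by positivity
    have p3 : 0 ≤ s * B.card := by positivity
    by_cases hAs : s ≤ A.card
    · by_cases hBs : s ≤ B.card
      · linarith [h hAs hBs]
      · nlinarith [mul_le_mul_of_nonneg_left (not_le.1 hBs).le hA]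
    · nlinarith [mul_le_mul_of_nonneg_right (not_le.1 hAs).le hB]
  calc _ ≤ ∑ x ∈ A, ∑ y ∈ B, ((if G.Adj x y then 1 else 0 : ℝ) + if x = y then 1 else 0) := by
        refine Finset.sum_le_sum fun x _ ↦ Finset.sum_le_sum fun y _ ↦ ?_
        by_cases ha : G.Adj x y <;> by_cases hxy : x = y <;> simp [ha, hxy]
    _ ≤ _ := by
      simp only [Finset.sum_add_distrib]
      linarith

lemma IsLocallySparse.mono {c c' t : ℝ} (h : G.IsLocallySparse c t) (hc : c' ≤ c) :
    G.IsLocallySparse c' t := fun A B hA hB ↦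
  (h A B hA hB).trans (by gcongr)

lemma IsLocallySparse.one_lt [Fintype V] {c t : ℝ} (h : G.IsLocallySparse c t) (hc : 0 < c)
    (he : 0 < G.edgeFinset.card) : 1 < t := by
  by_contra! ht
  obtain ⟨e, he⟩ := Finset.card_pos.1 he
  induction e using Sym2.ind with
  | _ a b =>
    have hab : G.Adj a b := by simpa using he
    have h1 := h {a} {b} (by simpa using ht) (by simpa using ht)
    have h2 : 0 < (G.interedges {a} {b}).card :=
      Finset.card_pos.2 ⟨(a, b), G.mem_interedges_iff.2 ⟨by simp, by simp, hab⟩⟩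
    have h3 : (1 : ℝ) ≤ (G.interedges {a} {b}).card := by exact_mod_cast h2
    simp only [Finset.card_singleton, Nat.cast_one, mul_one] at h1
    linarith

end

/-! ### The normalized adjacency matrix -/

open scoped Matrix

section

variable {V : Type*} [Fintype V] (G : SimpleGraph V) [DecidableRel G.Adj]

/-- The degree of `x`, raised to `δ` where it is smaller. -/
noncomputable def raisedDegree (δ : ℝ) (x : V) : ℝ := max (G.degree x) δ

/-- The adjacency matrix with the entry at `(x, y)` divided by the square roots of the raised degrees
of `x` and `y`. Raising the degrees to `δ`, of the order of the average degree, makes all rows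
small, as a minimum degree would, and leaves a spectral radius of at least `1 / 2`. -/
noncomputable def normAdj (δ : ℝ) : Matrix V V ℝ := fun x y ↦
  if G.Adj x y then (√(G.raisedDegree δ x))⁻¹ * (√(G.raisedDegree δ y))⁻¹ else 0

variable {G} {δ : ℝ}

lemma raisedDegree_pos (hδ : 0 < δ) (x : V) : 0 < G.raisedDegree δ x :=
  hδ.trans_le (le_max_right _ _)

lemma normAdj_isSymm : (G.normAdj δ).IsSymm := by
  ext x y
  simp only [Matrix.transpose_apply, normAdj, G.adj_comm y x, mul_comm]

lemma normAdj_nonneg (x y : V) : 0 ≤ G.normAdj δ x y := by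
  simp only [normAdj]
  split_ifs <;> positivity

lemma adj_of_normAdj_ne_zero {x y : V} (h : G.normAdj δ x y ≠ 0) : G.Adj x y := by
  by_contra hn
  exact h (if_neg hn)

variable [DecidableEq V]

lemma powRowSq_one_normAdj_le (hδ : 0 < δ) (x : V) : (G.normAdj δ).powRowSq 1 x ≤ 1 / δ := by
  have hD := G.raisedDegree_pos hδ
  have hterm : ∀ y, (G.normAdj δ ^ 1) x y ^ 2
      ≤ if G.Adj x y then (G.raisedDegree δ x)⁻¹ * δ⁻¹ else 0 := fun y ↦ by
    rw [pow_one, normAdj]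
    split_ifs
    · rw [mul_pow, inv_pow, inv_pow, Real.sq_sqrt (hD x).le, Real.sq_sqrt (hD y).le]
      have := inv_anti₀ hδ (le_max_right (G.degree y : ℝ) δ)
      exact mul_le_mul_of_nonneg_left this (inv_nonneg.2 (hD x).le)
    · simp
  refine (Finset.sum_le_sum fun y _ ↦ hterm y).trans ?_
  rw [← Finset.sum_filter, ← G.neighborFinset_eq_filter, Finset.sum_const, nsmul_eq_mul,
    card_neighborFinset_eq_degree, ← mul_assoc, one_div]
  refine mul_le_of_le_one_left (inv_nonneg.2 hδ.le) ?_
  rw [← div_eq_mul_inv, div_le_one (hD x)]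
  exact le_max_left _ _

/-- Testing with the vector of square roots of the raised degrees. -/
lemma pow_le_sum_powRowSq_normAdj (hδ : 0 < δ) (he : 0 < G.edgeFinset.card)
    (hn : Fintype.card V * δ ≤ 2 * G.edgeFinset.card) (ℓ : ℕ) :
    (1 / 4 : ℝ) ^ ℓ ≤ ∑ x, (G.normAdj δ).powRowSq ℓ x := by
  have hD := G.raisedDegree_pos hδ
  set w : V → ℝ := fun x ↦ √(G.raisedDegree δ x) with hw
  have hw0 : ∀ x, 0 < w x := fun x ↦ Real.sqrt_pos.2 (hD x)
  have hdeg : ∑ x, (G.degree x : ℝ) = 2 * G.edgeFinset.card := by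
    exact_mod_cast G.sum_degrees_eq_twice_card_edges
  have hNw : ∀ x, (G.normAdj δ *ᵥ w) x = (w x)⁻¹ * G.degree x := fun x ↦ by
    have hterm : ∀ y, G.normAdj δ x y * w y = if G.Adj x y then (w x)⁻¹ else 0 := fun y ↦ by
      simp only [normAdj, hw]
      split_ifs
      · rw [inv_mul_cancel_right₀ (hw0 y).ne']
      · simp
    simp only [Matrix.mulVec, dotProduct, hterm]
    rw [← Finset.sum_filter, ← G.neighborFinset_eq_filter, Finset.sum_const, nsmul_eq_mul,
      card_neighborFinset_eq_degree, mul_comm]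
  have hinner : ∑ x, w x * (G.normAdj δ *ᵥ w) x = 2 * G.edgeFinset.card := by
    rw [← hdeg]
    exact Finset.sum_congr rfl fun x _ ↦ by rw [hNw, mul_inv_cancel_left₀ (hw0 x).ne']
  set b : ℕ → ℝ := fun j ↦ ∑ x, ((G.normAdj δ ^ j) *ᵥ w) x ^ 2 with hb
  have hconv : IsLogConvexSeq b := normAdj_isSymm.isLogConvexSeq_mulVec w
  have hb0 : b 0 = ∑ x, w x ^ 2 := by simp [hb]
  have hb0le : b 0 ≤ 4 * G.edgeFinset.card := by
    have h1 : ∀ x, w x ^ 2 ≤ G.degree x + δ := fun x ↦ by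
      rw [hw, Real.sq_sqrt (hD x).le]
      exact max_le (by linarith) (by linarith [(Nat.cast_nonneg (G.degree x) : (0 : ℝ) ≤ _)])
    calc b 0 ≤ ∑ x, ((G.degree x : ℝ) + δ) := hb0 ▸ Finset.sum_le_sum fun x _ ↦ h1 x
      _ = 2 * G.edgeFinset.card + Fintype.card V * δ := by
        rw [Finset.sum_add_distrib, hdeg]; simp
      _ ≤ _ := by linarith
  have hcs : (2 * (G.edgeFinset.card : ℝ)) ^ 2 ≤ b 0 * b 1 := by
    rw [← hinner, hb0]
    simp only [hb, pow_one]
    exact Finset.sum_mul_sq_le_sq_mul_sq _ _ _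
  have he' : (0 : ℝ) < G.edgeFinset.card := by exact_mod_cast he
  have hb0pos : 0 < b 0 := by
    refine (hconv.nonneg 0).lt_of_ne fun h ↦ ?_
    rw [← h, zero_mul] at hcs
    nlinarith
  have hb1 : 1 / 4 * b 0 ≤ b 1 := by
    refine le_of_mul_le_mul_left ?_ hb0pos
    nlinarith
  have h1 := hconv.pow_mul_le (by norm_num) hb0pos hb1 ℓ
  have h2 := (G.normAdj δ).sum_mulVec_sq_le ℓ w
  rw [← hb0] at h2
  exact le_of_mul_le_mul_right (h1.trans h2) hb0pos

/-- The case of relative density `1 / (16 * ℓ ^ 2)`, small enough for a union bound over the pairs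
of positions. -/
theorem cycleGraph_isIndContained_of_sparse {τ : ℝ} {ℓ : ℕ} (hℓ : 2 ≤ ℓ) (hδ : 0 < δ) (hτ : 0 < τ)
    (he : 0 < G.edgeFinset.card) (hn : Fintype.card V * δ ≤ 2 * G.edgeFinset.card)
    (hbig : (1024 * ℓ ^ 4 * τ) ^ (ℓ - 1) * Fintype.card V * 4 ^ ℓ ≤ δ ^ ℓ)
    (hsp : ∀ A B : Finset V, ∑ x ∈ A, ∑ y ∈ B, (if G.Adj x y ∨ x = y then 1 else 0 : ℝ)
      ≤ 1 / (16 * ℓ ^ 2) * A.card * B.card + τ * (A.card + B.card)) :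
    (cycleGraph (2 * ℓ)).IsIndContained G := by
  have : NeZero (2 * ℓ) := ⟨by omega⟩
  have hℓ0 : (0 : ℝ) < ℓ := by exact_mod_cast (by omega : 0 < ℓ)
  set N := G.normAdj δ with hN
  have hsymm : N.IsSymm := normAdj_isSymm
  set S : ℕ → ℝ := fun j ↦ ∑ x, N.powRowSq j x with hS
  have hconv : IsLogConvexSeq S := hsymm.isLogConvexSeq_sum_powRowSq
  have hSℓ : (1 / 4 : ℝ) ^ ℓ ≤ S ℓ := pow_le_sum_powRowSq_normAdj hδ he hn ℓ
  have hSℓ0 : 0 < S ℓ := lt_of_lt_of_le (by positivity) hSℓ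
  have hS1 : S 1 ≤ Fintype.card V / δ := by
    calc S 1 ≤ ∑ _x : V, 1 / δ := Finset.sum_le_sum fun x _ ↦ powRowSq_one_normAdj_le hδ x
      _ = _ := by simp [div_eq_mul_inv]
  obtain ⟨n, rfl⟩ : ∃ n, ℓ = n + 1 := ⟨ℓ - 1, by omega⟩
  rw [Nat.add_sub_cancel] at hbig
  have hSn : 0 < S n := by
    refine (hconv.nonneg n).lt_of_ne fun h ↦ ?_
    have := hconv.sq_le n
    rw [← h, zero_mul] at this
    exact absurd this (not_le.2 (by positivity))
  set q : ℝ := 16 * ((n + 1 : ℕ) : ℝ) ^ 2 with hq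
  have hq0 : 0 < q := by positivity
  have hq4 : 1024 * ((n + 1 : ℕ) : ℝ) ^ 4 * τ = 4 * q ^ 2 * τ := by rw [hq]; ring
  rw [hq4] at hbig
  -- `S 1 ≤ |V| / δ` and `hbig` force the last ratio of `S` above `1 / δ`, by a factor of order `τ`.
  have hratio : 4 * q ^ 2 * τ / δ * S n ≤ S (n + 1) := by
    refine hconv.mul_le_of_pow_mul_le (by positivity) hSn (by omega) ?_
    calc (4 * q ^ 2 * τ / δ) ^ n * S 1
        ≤ (4 * q ^ 2 * τ / δ) ^ n * (Fintype.card V / δ) := by gcongr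
      _ = (4 * q ^ 2 * τ) ^ n * Fintype.card V / δ ^ (n + 1) := by
        rw [div_pow, pow_succ]; field_simp; ring
      _ ≤ (1 / 4) ^ (n + 1) := by
        rw [div_le_iff₀ (by positivity), one_div, inv_pow, inv_mul_eq_div,
          le_div_iff₀ (by positivity)]
        exact hbig
      _ ≤ _ := hSℓ
  obtain ⟨x, hx, hfar⟩ := hsymm.exists_cycleWeight_pos (fun x y ↦ normAdj_nonneg x y)
    (fun x ↦ powRowSq_one_normAdj_le hδ x) (by positivity) hτ.le
    (show 0 < 2 * q * τ by positivity) (fun x y ↦ G.Adj x y ∨ x = y) hsp hℓ (by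
      rw [Nat.add_sub_cancel]
      change 2 * ((n + 1 : ℕ) : ℝ) ^ 2 * (2 * q * τ * (2 * (1 / δ * S n))
        + (1 / q + 2 * τ / (2 * q * τ)) * S (n + 1)) < S (n + 1)
      have e1 : 2 * q * τ * (2 * (1 / δ * S n)) = 1 / q * (4 * q ^ 2 * τ / δ * S n) := by
        field_simp; ring
      have e2 : 2 * τ / (2 * q * τ) = 1 / q := by field_simp
      have e3 : 2 * ((n + 1 : ℕ) : ℝ) ^ 2 = q / 8 := by rw [hq]; ring
      rw [e1, e2, e3]
      calc q / 8 * (1 / q * (4 * q ^ 2 * τ / δ * S n) + (1 / q + 1 / q) * S (n + 1))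
          ≤ q / 8 * (1 / q * S (n + 1) + (1 / q + 1 / q) * S (n + 1)) := by gcongr
        _ = 3 / 8 * S (n + 1) := by field_simp; ring
        _ < S (n + 1) := by linarith)
  refine cycleGraph_isIndContained_of_closedWalk hℓ x (fun i ↦ ?_) hfar
  exact adj_of_normAdj_ne_zero (Finset.prod_ne_zero_iff.1 hx.ne' i (Finset.mem_univ i))

end

end SimpleGraph

/-! ### The edge condition -/

lemma pow_mul_pow_le_of_rpow_le {C t n e : ℝ} (hC : 0 ≤ C) (ht : 0 < t) (hn : 0 < n) {ℓ : ℕ}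
    (hℓ : 1 ≤ ℓ)
    (h : C * t ^ (1 - 1 / (ℓ : ℝ)) * n ^ (1 + 1 / (ℓ : ℝ)) ≤ e) :
    C ^ ℓ * t ^ (ℓ - 1) * n ≤ (e / n) ^ ℓ := by
  have hℓ0 : (ℓ : ℝ) ≠ 0 := by positivity
  have h1 : (t ^ (1 - 1 / (ℓ : ℝ))) ^ ℓ = t ^ (ℓ - 1) := by
    rw [← Real.rpow_natCast, ← Real.rpow_mul ht.le, ← Real.rpow_natCast t (ℓ - 1)]
    congr 1
    push_cast [hℓ]
    field_simp
  have h2 : (n ^ (1 + 1 / (ℓ : ℝ))) ^ ℓ = n * n ^ ℓ := by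
    rw [← Real.rpow_natCast, ← Real.rpow_mul hn.le, ← pow_succ', ← Real.rpow_natCast n (ℓ + 1)]
    congr 1
    push_cast
    field_simp
  have h3 := pow_le_pow_left₀ (by positivity) h ℓ
  rw [mul_pow, mul_pow, h1, h2] at h3
  rw [div_pow, le_div_iff₀ (by positivity)]
  linarith

theorem theorem1p2 (c : ℝ) (hc : 0 < c) (ℓ : ℕ) (hℓ : 2 ≤ ℓ) :
    ∃ C : ℝ, 1 < C ∧
      ∀ (V : Type*) [Fintype V] [Nonempty V] [DecidableEq V]
        (G : SimpleGraph V) [DecidableRel G.Adj] (t : ℝ),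
        0 < t →
        G.IsLocallySparse c t →
        C * t ^ (1 - 1 / (ℓ : ℝ)) * (Fintype.card V : ℝ) ^ (1 + 1 / (ℓ : ℝ))
          ≤ (G.edgeFinset.card : ℝ) →
        (SimpleGraph.cycleGraph (2 * ℓ)).IsIndContained G := by
  have hℓ1 : (1 : ℝ) ≤ ℓ := by exact_mod_cast (by omega : 1 ≤ ℓ)
  have hℓ2 : (1 : ℝ) ≤ ℓ ^ 2 := one_le_pow₀ hℓ1
  have hℓ4 : (1 : ℝ) ≤ ℓ ^ 4 := one_le_pow₀ hℓ1
  obtain ⟨K, hK1, hK⟩ := SimpleGraph.exists_forall_isIndContained_of_dense_pair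
    (lt_min hc one_pos) (min_le_right c 1) (show 0 < 1 / (16 * (ℓ : ℝ) ^ 2) by positivity)
    (by rw [div_le_one (by positivity)]; linarith) (SimpleGraph.cycleGraph (2 * ℓ))
    (SimpleGraph.cycleGraph.bicoloring_of_even (2 * ℓ) (even_two_mul ℓ))
  refine ⟨4 * (1024 * ℓ ^ 4 * (K + 1)), by nlinarith, fun V _ _ _ G _ t ht hG hE ↦ ?_⟩
  have hn : (0 : ℝ) < Fintype.card V := by exact_mod_cast Fintype.card_pos
  have he' : (0 : ℝ) < G.edgeFinset.card := lt_of_lt_of_le (by positivity) hE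
  have he : 0 < G.edgeFinset.card := by exact_mod_cast he'
  have ht1 : 1 < t := hG.one_lt hc he
  by_contra hno
  refine hno (SimpleGraph.cycleGraph_isIndContained_of_sparse (τ := K * t + 1)
    (δ := G.edgeFinset.card / Fintype.card V) hℓ (by positivity) (by positivity) he ?_ ?_
    fun A B ↦ SimpleGraph.sum_sum_adj_or_eq_le A B (by positivity) (by positivity)
      fun hA hB ↦ ?_)
  · rw [mul_div_cancel₀ _ hn.ne']
    linarith
  · refine le_trans ?_ (pow_mul_pow_le_of_rpow_le (by positivity) ht hn (by omega) hE)
    have hM : 1 ≤ 1024 * (ℓ : ℝ) ^ 4 * (K + 1) := by nlinarith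
    calc (1024 * (ℓ : ℝ) ^ 4 * (K * t + 1)) ^ (ℓ - 1) * Fintype.card V * 4 ^ ℓ
        ≤ (1024 * (ℓ : ℝ) ^ 4 * ((K + 1) * t)) ^ (ℓ - 1) * Fintype.card V * 4 ^ ℓ := by
          gcongr
          linarith
      _ = (1024 * (ℓ : ℝ) ^ 4 * (K + 1)) ^ (ℓ - 1) * (4 ^ ℓ * t ^ (ℓ - 1) * Fintype.card V) := by
          rw [← mul_assoc _ (K + 1) t, mul_pow _ t]; ring
      _ ≤ (1024 * (ℓ : ℝ) ^ 4 * (K + 1)) ^ ℓ * (4 ^ ℓ * t ^ (ℓ - 1) * Fintype.card V) := by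
          gcongr
          · omega
      _ = _ := by rw [mul_pow 4]; ring
  · by_contra! hdense
    exact hno (hK G t ht1.le (hG.mono (min_le_left c 1)) A B hA hB hdense)
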